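/- **Theorem 1.4 (Non-existence for large sources).** Let $N\ge 1$, let $\Omega\subset\mathbb{R}^N$ be a bounded domain with boundary of class $C^2$, and let $\sigma\in(0,1)$. For bounded measurable $u:\mathbb{R}^N\to\mathbb{R}$ of class $C^2$ in $\Omega$ and $x\in\Omega$ let $$(-\Delta)^\sigma u(x)=c_{N,\sigma}\lim_{\varepsilon\downarrow0}\int_{\mathbb{R}^N\setminus B_\varepsilon(x)}\frac{u(x)-u(y)}{|x-y|^{N+2\sigma}}\,dy,\qquad c_{N,\sigma}=\frac{\sigma\,4^\sigma\,\Gamma(N/2+\sigma)}{\pi^{N/2}\,\Gamma(1-\sigma)},$$ where $c_{N,\sigma}$ is the normalization for which the Fourier symbol of $(-\Delta)^\sigma$ is $|\xi|^{2\sigma}$. Let $f\in L^\infty_{\mathrm{loc}}(\Omega)$ satisfy $$\operatorname{dist}(x,\partial\Omega)^2 f(x)\ge\kappa\quad\text{for a.e. }x\in\Omega,$$ for some $\kappa>0$. Then, for every $p$ with $1\le p<1/\sigma$, the problem $$\begin{cases}-\Delta u+\big|(-\Delta)^\sigma u\big|^{p-1}(-\Delta)^\sigma u=f & \text{a.e.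 in }\Omega,\\ u=0 & \text{on }\partial\Omega,\\ u=0 & \text{a.e. in }\mathbb{R}^N\setminus\overline\Omega\end{cases}$$ has no solution $u\in L^\infty(\mathbb{R}^N)\cap C^2(\Omega)\cap C^0(\overline\Omega)$. -/

import Mathlib

open MeasureTheory Set Filter Topology

namespace MixedPower

noncomputable section

/-- `Ω` is a bounded domain (non-empty, open, connected) of `ℝ^N`. -/
structure IsBoundedDomain {N : ℕ} (Ω : Set (EuclideanSpace ℝ (Fin N))) : Prop where
  isOpen : IsOpen Ω
  isConnected : IsConnected Ω
  isBounded : Bornology.IsBounded Ω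

/-- The boundary of the open set `Ω` is of class `C²`: near each of its points, `Ω` is the strict
sublevel set `{ρ < 0}` of a `C²` function `ρ` that vanishes at the point and has non-zero
differential there. By the implicit function theorem this is the same as `Ω` being, near the
point and up to a rotation, the subgraph of a `C²` function. -/
def HasC2Boundary {N : ℕ} (Ω : Set (EuclideanSpace ℝ (Fin N))) : Prop :=
  ∀ x₀ ∈ frontier Ω, ∃ (U : Set (EuclideanSpace ℝ (Fin N)))
      (ρ : EuclideanSpace ℝ (Fin N) → ℝ),
    IsOpen U ∧ x₀ ∈ U ∧ ContDiffOn ℝ 2 ρ U ∧ ρ x₀ = 0 ∧ fderiv ℝ ρ x₀ ≠ 0 ∧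
      Ω ∩ U = {x ∈ U | ρ x < 0}

/-- `f ∈ L^∞_loc(Ω)`: `f` is (a.e. strongly measurable and) essentially bounded on every compact
subset of `Ω`. -/
def MemLinftyLoc {N : ℕ} (Ω : Set (EuclideanSpace ℝ (Fin N)))
    (f : EuclideanSpace ℝ (Fin N) → ℝ) : Prop :=
  ∀ K : Set (EuclideanSpace ℝ (Fin N)), IsCompact K → K ⊆ Ω →
    MemLp f ⊤ (volume.restrict K)

/-- The normalization constant `c_{N,σ} = σ 4^σ Γ(N/2 + σ) / (π^{N/2} Γ(1 - σ))`, for which the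
Fourier symbol of the fractional Laplacian is `|ξ|^{2σ}`. -/
def fracConst (N : ℕ) (σ : ℝ) : ℝ :=
  σ * (4 : ℝ) ^ σ * Real.Gamma ((N : ℝ) / 2 + σ) /
    (Real.pi ^ ((N : ℝ) / 2) * Real.Gamma (1 - σ))

/-- The integral over `ℝ^N ∖ B_ε(x)` of `(u(x) - u(y)) / |x - y|^{N+2σ}`. -/
def truncatedFracIntegral {N : ℕ} (σ : ℝ) (u : EuclideanSpace ℝ (Fin N) → ℝ)
    (x : EuclideanSpace ℝ (Fin N)) (ε : ℝ) : ℝ :=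
  ∫ y in (Metric.ball x ε)ᶜ, (u x - u y) / ‖x - y‖ ^ ((N : ℝ) + 2 * σ)

/-- The fractional Laplacian `(-Δ)^σ u(x)`, as a principal value: `c_{N,σ}` times the limit as
`ε ↓ 0` of the integral over `ℝ^N ∖ B_ε(x)`. The limit exists at every point of an open set where
`u` is `C²`, if `u` is also in `L^∞(ℝ^N)`, and it is only used for such functions. -/
def fracLaplacian {N : ℕ} (σ : ℝ) (u : EuclideanSpace ℝ (Fin N) → ℝ)
    (x : EuclideanSpace ℝ (Fin N)) : ℝ :=
  fracConst N σ * limUnder (𝓝[>] (0 : ℝ)) (truncatedFracIntegral σ u x)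

/-- `u ∈ L^∞(ℝ^N) ∩ C²(Ω) ∩ C⁰(closure Ω)` is a solution of
`-Δu + |(-Δ)^σ u|^{p-1} (-Δ)^σ u = f` in `Ω`, `u = g` on `∂Ω`, `u = h` in `ℝ^N ∖ closure Ω`.
Since `f` and `h` are elements of Lebesgue spaces, the equation and the exterior condition are
required almost everywhere; the boundary condition is required at every point. -/
structure IsSolution {N : ℕ} (Ω : Set (EuclideanSpace ℝ (Fin N))) (σ p : ℝ)
    (f g h u : EuclideanSpace ℝ (Fin N) → ℝ) : Prop where
  memLinfty : MemLp u ⊤ volume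
  contDiffOn : ContDiffOn ℝ 2 u Ω
  continuousOn : ContinuousOn u (closure Ω)
  equation : ∀ᵐ x ∂(volume.restrict Ω),
    -(Laplacian.laplacian u x) + |fracLaplacian σ u x| ^ (p - 1) * fracLaplacian σ u x = f x
  boundary : ∀ x ∈ frontier Ω, u x = g x
  exterior : ∀ᵐ x ∂(volume.restrict (closure Ω)ᶜ), u x = h x

end

end MixedPower

/-! The zero extension `v` of a solution is continuous and bounded, and its operator is continuous
in `Ω`, so `κ ≤ d² · mixedOperator σ p v` holds at every point of `Ω`, where `d` is the distance to
the boundary. At a negative minimum the operator would be nonpositive, hence `v ≥ 0`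
(`nonneg_of_mixedOperator_pos`).

Near the boundary, take `r = d(z)/2` and compare `v` with the paraboloid of height `η` and width `r`
centred at `z`. If `v z < η`, then `v` minus the paraboloid has an interior minimum point, where the
local term is at most `2Nη/r²` and the nonlocal one at most `(Aη r^(-2σ))^p` (`mixedOperator_le`).
Since `σp ≤ 1` and `r, η ≤ 1`, the sum is at most a constant times `η/r²`, while the operator is at
least `κ/(9r²)`. A small `η` independent of `z` is therefore impossible to undercut
(`le_of_mixedOperator_ge`): `v` stays above `η` up to the boundary, where it must vanish
continuously. -/

namespace MixedPower

/-! ### Second differences of C² functions -/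

/-- The symmetric second difference of `v` at `x`, with the sign of `-Δ`. -/
def secondDiff {E : Type*} [AddCommGroup E] (v : E → ℝ) (x h : E) : ℝ :=
  2 * v x - v (x + h) - v (x - h)

/-- The derivative of `t ↦ v(x+th) + v(x-th)` is at most `2K‖h‖²`, with `K` a Lipschitz constant of
`fderiv ℝ v` near `x₀`. Uniformity in `x` is what later gives a dominating function for continuity.
-/
theorem exists_secondDiff_le_sq {E : Type*} [NormedAddCommGroup E] [NormedSpace ℝ E]
    {v : E → ℝ} {x₀ : E} (hv : ContDiffAt ℝ 2 v x₀) :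
    ∃ ρ > 0, ∃ C ≥ 0, ∀ x, dist x x₀ < ρ → ∀ h, ‖h‖ < ρ →
      |secondDiff v x h| ≤ C * ‖h‖ ^ 2 := by
  have h1 : ContDiffAt ℝ 1 (fderiv ℝ v) x₀ := hv.fderiv_right (by norm_num)
  obtain ⟨K, s, hs, hK⟩ := (h1.hasStrictFDerivAt one_ne_zero).exists_lipschitzOnWith
  have hd : ∀ᶠ y in 𝓝 x₀, DifferentiableAt ℝ v y :=
    (hv.eventually (by simp)).mono fun y hy => hy.differentiableAt (by norm_num)
  obtain ⟨δ, hδ, hball⟩ := Metric.eventually_nhds_iff_ball.1 (hd.and (eventually_mem_set.2 hs))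
  refine ⟨δ / 2, by positivity, 2 * K, by positivity, fun x hx h hh => ?_⟩
  have hmem : ∀ t : ℝ, |t| ≤ 1 → x + t • h ∈ Metric.ball x₀ δ := by
    intro t ht
    rw [Metric.mem_ball, dist_eq_norm]
    rw [dist_eq_norm] at hx
    calc ‖x + t • h - x₀‖ = ‖(x - x₀) + t • h‖ := by congr 1; abel
      _ ≤ ‖x - x₀‖ + |t| * ‖h‖ := by
        simpa [norm_smul] using norm_add_le (x - x₀) (t • h)
      _ < δ := by nlinarith [norm_nonneg h, abs_nonneg t]
  have hder : ∀ t : ℝ, |t| ≤ 1 →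
      HasDerivAt (fun t : ℝ => v (x + t • h)) (fderiv ℝ v (x + t • h) h) t := by
    intro t ht
    have hl : HasDerivAt (fun t : ℝ => x + t • h) h t := by
      simpa using ((hasDerivAt_id t).smul_const h).const_add x
    exact (hball _ (hmem t ht)).1.hasFDerivAt.comp_hasDerivAt t hl
  have hder' : ∀ t : ℝ, |t| ≤ 1 →
      HasDerivAt (fun t : ℝ => v (x + t • h) + v (x + (-t) • h))
        (fderiv ℝ v (x + t • h) h - fderiv ℝ v (x + (-t) • h) h) t := by
    intro t ht
    have h2 := (hder (-t) (by simpa using ht)).scomp t (hasDerivAt_neg t)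
    have h3 := (hder t ht).add h2
    exact h3.congr_deriv (by simp [sub_eq_add_neg])
  have key := norm_image_sub_le_of_norm_deriv_le_segment_01'
    (f := fun t : ℝ => v (x + t • h) + v (x + (-t) • h)) (C := 2 * K * ‖h‖ ^ 2)
    (fun t ht => (hder' t (abs_le.2 ⟨by linarith [ht.1], ht.2⟩)).hasDerivWithinAt) (by
      intro t ht
      have ht' : |t| ≤ 1 := abs_le.2 ⟨by linarith [ht.1], ht.2.le⟩
      have hL := hK.dist_le_mul _ (hball _ (hmem t ht')).2 _
        (hball _ (hmem (-t) (by simpa using ht'))).2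
      rw [dist_eq_norm, dist_eq_norm] at hL
      have e : x + t • h - (x + (-t) • h) = (2 * t) • h := by module
      rw [e, norm_smul, Real.norm_eq_abs, abs_mul, abs_two, abs_of_nonneg ht.1] at hL
      rw [← sub_apply]
      refine (ContinuousLinearMap.le_opNorm _ _).trans ?_
      have hn := norm_nonneg h
      calc _ ≤ (K * (2 * t * ‖h‖)) * ‖h‖ := by gcongr
        _ ≤ (K * (2 * 1 * ‖h‖)) * ‖h‖ := by gcongr; exact ht.2.le
        _ = _ := by ring)
  rw [Real.norm_eq_abs, ← abs_neg] at key
  refine le_of_eq_of_le ?_ key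
  simp only [secondDiff]
  congr 1
  simp only [one_smul, zero_smul, neg_smul, neg_zero, add_zero, ← sub_eq_add_neg]
  ring

theorem exists_secondDiff_le_min {E : Type*} [NormedAddCommGroup E] [NormedSpace ℝ E]
    {v : E → ℝ} {x₀ : E} (hv : ContDiffAt ℝ 2 v x₀) {M : ℝ} (hM : ∀ x, |v x| ≤ M) :
    ∃ ρ > 0, ∃ K : ℝ, ∀ x, dist x x₀ < ρ → ∀ h,
      |secondDiff v x h| ≤ K * min 1 (‖h‖ ^ 2) := by
  obtain ⟨ρ, hρ, C, hC, hb⟩ := exists_secondDiff_le_sq hv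
  have hM0 : 0 ≤ M := (abs_nonneg _).trans (hM x₀)
  set δ := min ρ 1 with hδ
  have hδ0 : 0 < δ := lt_min hρ one_pos
  have hδ1 : δ ≤ 1 := min_le_right _ _
  -- The second summand absorbs the trivial bound `4M` when `‖h‖ ≥ δ`, where `min 1 (‖h‖²) ≥ δ²`.
  refine ⟨ρ, hρ, C + 4 * M / δ ^ 2, fun x hx h => ?_⟩
  rcases lt_or_ge ‖h‖ δ with hh | hh
  · have h1 : ‖h‖ ^ 2 ≤ 1 := by nlinarith [norm_nonneg h]
    rw [min_eq_right h1]
    refine (hb x hx h (hh.trans_le (min_le_left _ _))).trans ?_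
    gcongr
    have : 0 ≤ 4 * M / δ ^ 2 := by positivity
    linarith
  · have h1 : δ ^ 2 ≤ min 1 (‖h‖ ^ 2) :=
      le_min (by nlinarith) (by gcongr)
    have h2 : |secondDiff v x h| ≤ 4 * M := by
      have a1 := abs_le.1 (hM x)
      have a2 := abs_le.1 (hM (x + h))
      have a3 := abs_le.1 (hM (x - h))
      rw [abs_le, secondDiff]
      constructor <;> linarith
    calc _ ≤ 4 * M := h2
      _ = 4 * M / δ ^ 2 * δ ^ 2 := by field_simp
      _ ≤ 4 * M / δ ^ 2 * min 1 (‖h‖ ^ 2) := by gcongr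
      _ ≤ _ := by
        have : 0 ≤ min 1 (‖h‖ ^ 2) := by positivity
        gcongr
        linarith

/-! ### One-sided Hessian and Laplacian bounds -/

/-- A negative second derivative would make `t` a local maximum too, so `g` would be locally
constant. -/
theorem IsLocalMin.deriv_deriv_nonneg {g : ℝ → ℝ} {t : ℝ} (hg : IsLocalMin g t)
    (hc : ContinuousAt g t) : 0 ≤ deriv (deriv g) t := by
  by_contra! hneg
  have hmax := isLocalMax_of_deriv_deriv_neg hneg hg.deriv_eq_zero hc
  have hconst : g =ᶠ[𝓝 t] fun _ => g t := by
    filter_upwards [hg, hmax] with s h1 h2 using le_antisymm h2 h1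
  have := hconst.deriv.deriv_eq
  simp at this
  linarith

/-- Adding `2at²` to the symmetrized restriction of `v` to a line creates a local minimum at `0`. -/
theorem iteratedFDeriv_two_ge {E : Type*} [NormedAddCommGroup E] [NormedSpace ℝ E]
    {v : E → ℝ} {x : E} (hv : ContDiffAt ℝ 2 v x) {a : ℝ}
    (h : ∀ᶠ h in 𝓝 (0 : E), secondDiff v x h ≤ 2 * a * ‖h‖ ^ 2) {e : E} (he : ‖e‖ = 1) :
    -2 * a ≤ iteratedFDeriv ℝ 2 v x ![e, e] := by
  set g : ℝ → ℝ := fun t => v (x + t • e) + v (x + (-t) • e) + 2 * a * t ^ 2 with hg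
  have hline : ∀ t : ℝ, HasDerivAt (fun t : ℝ => x + t • e) e t := fun t => by
    simpa using ((hasDerivAt_id t).smul_const e).const_add x
  have hline' : ∀ t : ℝ, HasDerivAt (fun t : ℝ => x + (-t) • e) (-e) t := fun t => by
    simpa using ((hasDerivAt_neg t).smul_const e).const_add x
  have hd : ∀ᶠ y in 𝓝 x, DifferentiableAt ℝ v y :=
    (hv.eventually (by simp)).mono fun y hy => hy.differentiableAt (by norm_num)
  have ht1 : Tendsto (fun t : ℝ => x + t • e) (𝓝 0) (𝓝 x) := by
    simpa using (hline 0).continuousAt.tendsto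
  have ht2 : Tendsto (fun t : ℝ => x + (-t) • e) (𝓝 0) (𝓝 x) := by
    simpa using (hline' 0).continuousAt.tendsto
  have hg1 : ∀ᶠ t in 𝓝 (0 : ℝ), HasDerivAt g
      (fderiv ℝ v (x + t • e) e - fderiv ℝ v (x + (-t) • e) e + 4 * a * t) t := by
    filter_upwards [ht1.eventually hd, ht2.eventually hd] with t h1 h2
    have d1 := h1.hasFDerivAt.comp_hasDerivAt t (hline t)
    have d2 := h2.hasFDerivAt.comp_hasDerivAt t (hline' t)
    have d3 := ((hasDerivAt_id t).pow 2).const_mul (2 * a)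
    refine ((d1.add d2).add d3).congr_deriv ?_
    simp
    ring
  have hmin : IsLocalMin g 0 := by
    have ht3 : Tendsto (fun t : ℝ => t • e) (𝓝 0) (𝓝 0) := by
      have : Continuous fun t : ℝ => t • e := by fun_prop
      simpa using this.tendsto 0
    filter_upwards [ht3.eventually h] with t ht
    rw [secondDiff, norm_smul, he, Real.norm_eq_abs, mul_one, sq_abs] at ht
    simp only [hg, neg_smul, zero_smul, ← sub_eq_add_neg, add_zero, sub_zero]
    simp
    linarith
  have hD : DifferentiableAt ℝ (fderiv ℝ v) x :=
    (hv.fderiv_right (m := 1) (by norm_num)).differentiableAt (by norm_num)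
  have hg2 : HasDerivAt (deriv g) (2 * fderiv ℝ (fderiv ℝ v) x e e + 4 * a) 0 := by
    have d1 : HasDerivAt (fun t : ℝ => fderiv ℝ v (x + t • e)) (fderiv ℝ (fderiv ℝ v) x e) 0 := by
      have : HasFDerivAt (fderiv ℝ v) (fderiv ℝ (fderiv ℝ v) x) (x + (0 : ℝ) • e) := by
        simpa using hD.hasFDerivAt
      exact this.comp_hasDerivAt 0 (hline 0)
    have d2 : HasDerivAt (fun t : ℝ => fderiv ℝ v (x + (-t) • e))
        (fderiv ℝ (fderiv ℝ v) x (-e)) 0 := by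
      have : HasFDerivAt (fderiv ℝ v) (fderiv ℝ (fderiv ℝ v) x) (x + (-(0 : ℝ)) • e) := by
        simpa using hD.hasFDerivAt
      exact this.comp_hasDerivAt 0 (hline' 0)
    have d3 := ((d1.clm_apply (hasDerivAt_const (0 : ℝ) e)).sub
      (d2.clm_apply (hasDerivAt_const (0 : ℝ) e))).add ((hasDerivAt_id (0 : ℝ)).const_mul (4 * a))
    refine (d3.congr_of_eventuallyEq (hg1.mono fun t ht => ?_)).congr_deriv ?_
    · simp [ht.deriv]
    · simp
      ring
  have := IsLocalMin.deriv_deriv_nonneg hmin hg1.self_of_nhds.continuousAt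
  rw [hg2.deriv] at this
  rw [iteratedFDeriv_two_apply]
  simp
  linarith

theorem neg_laplacian_le {N : ℕ} {v : EuclideanSpace ℝ (Fin N) → ℝ}
    {x : EuclideanSpace ℝ (Fin N)} (hv : ContDiffAt ℝ 2 v x) {a : ℝ}
    (h : ∀ᶠ h in 𝓝 (0 : EuclideanSpace ℝ (Fin N)), secondDiff v x h ≤ 2 * a * ‖h‖ ^ 2) :
    -(Laplacian.laplacian v x) ≤ 2 * a * N := by
  rw [InnerProductSpace.laplacian_eq_iteratedFDeriv_orthonormalBasis v
    (EuclideanSpace.basisFun (Fin N) ℝ)]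
  have : ∑ _i : Fin N, (-2 * a) ≤ ∑ i, iteratedFDeriv ℝ 2 v x
      ![EuclideanSpace.basisFun (Fin N) ℝ i, EuclideanSpace.basisFun (Fin N) ℝ i] :=
    Finset.sum_le_sum fun i _ => iteratedFDeriv_two_ge hv h (by simp)
  simp only [Finset.sum_const, Finset.card_univ, Fintype.card_fin, nsmul_eq_mul] at this
  linarith

theorem continuousAt_laplacian {N : ℕ} {v : EuclideanSpace ℝ (Fin N) → ℝ}
    {x : EuclideanSpace ℝ (Fin N)} (hv : ContDiffAt ℝ 2 v x) :
    ContinuousAt (Laplacian.laplacian v) x := by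
  rw [InnerProductSpace.laplacian_eq_iteratedFDeriv_orthonormalBasis v
    (EuclideanSpace.basisFun (Fin N) ℝ)]
  have h : ContinuousAt (iteratedFDeriv ℝ 2 v) x :=
    (hv.iteratedFDeriv_right (m := 0) (i := 2) (by norm_num)).continuousAt
  refine tendsto_finsetSum _ fun i _ => ?_
  exact (ContinuousMultilinearMap.apply ℝ (fun _ : Fin 2 => EuclideanSpace ℝ (Fin N)) ℝ
    ![EuclideanSpace.basisFun (Fin N) ℝ i, EuclideanSpace.basisFun (Fin N) ℝ i]).continuous
      |>.continuousAt.comp h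

/-! ### The singular kernel and its scaling -/

/-- The integrable majorant `min 1 |h|² / |h|^{N+2σ}` of bounded second differences. -/
noncomputable def levyKernel (N : ℕ) (σ : ℝ) (h : EuclideanSpace ℝ (Fin N)) : ℝ :=
  min 1 (‖h‖ ^ 2) / ‖h‖ ^ ((N : ℝ) + 2 * σ)

/-- The absolutely convergent, symmetrized form of the singular integral. -/
noncomputable def symmFracIntegral {N : ℕ} (σ : ℝ) (v : EuclideanSpace ℝ (Fin N) → ℝ)
    (x : EuclideanSpace ℝ (Fin N)) : ℝ :=
  2⁻¹ * ∫ h, secondDiff v x h / ‖h‖ ^ ((N : ℝ) + 2 * σ)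

section

variable {N : ℕ} {σ : ℝ}

theorem levyKernel_nonneg (h : EuclideanSpace ℝ (Fin N)) : 0 ≤ levyKernel N σ h := by
  unfold levyKernel; positivity

/-- In polar coordinates the integrand is `y^(1-2σ)` on `(0,1]` and `y^(-1-2σ)` beyond. -/
theorem integrable_levyKernel (hN : 1 ≤ N) (hσ0 : 0 < σ) (hσ1 : σ < 1) :
    Integrable (levyKernel N σ) := by
  have : Nonempty (Fin N) := ⟨⟨0, hN⟩⟩
  have key := (integrable_fun_norm_addHaar (E := EuclideanSpace ℝ (Fin N)) volume
    (f := fun y : ℝ => min 1 (y ^ 2) / y ^ ((N : ℝ) + 2 * σ))).2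
  refine key ?_
  rw [finrank_euclideanSpace_fin, ← Ioc_union_Ioi_eq_Ioi zero_le_one, integrableOn_union]
  have hpow : ∀ y : ℝ, 0 < y → y ^ (N - 1) = y ^ ((N : ℝ) - 1) := fun y hy => by
    rw [← Real.rpow_natCast, Nat.cast_sub hN, Nat.cast_one]
  constructor
  · have h1 : IntegrableOn (fun y : ℝ => y ^ (1 - 2 * σ)) (Ioc 0 1) :=
      (intervalIntegrable_iff_integrableOn_Ioc_of_le zero_le_one).1
        (intervalIntegral.intervalIntegrable_rpow' (by linarith))
    refine h1.congr_fun (fun y hy => ?_) measurableSet_Ioc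
    have hy2 : y ^ 2 ≤ 1 := by nlinarith [hy.1, hy.2]
    simp only [smul_eq_mul]
    rw [min_eq_right hy2, hpow y hy.1, ← Real.rpow_natCast y 2, ← mul_div_assoc,
      ← Real.rpow_add hy.1, ← Real.rpow_sub hy.1]
    congr 1
    push_cast
    ring
  · have h1 : IntegrableOn (fun y : ℝ => y ^ (-1 - 2 * σ)) (Ioi 1) :=
      integrableOn_Ioi_rpow_of_lt (by linarith) one_pos
    refine h1.congr_fun (fun y hy => ?_) measurableSet_Ioi
    have hy1 : 1 < y := hy
    have hy0 : 0 < y := one_pos.trans hy1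
    have hy2 : 1 ≤ y ^ 2 := by nlinarith
    simp only [smul_eq_mul]
    rw [min_eq_left hy2, hpow y hy0, ← mul_div_assoc, mul_one, ← Real.rpow_sub hy0]
    congr 1
    ring

theorem min_div_eq_levyKernel_inv_smul {r : ℝ} (hr : 0 < r) (h : EuclideanSpace ℝ (Fin N)) :
    min 1 (‖r⁻¹ • h‖ ^ 2) / ‖h‖ ^ ((N : ℝ) + 2 * σ) =
      r ^ (-((N : ℝ) + 2 * σ)) * levyKernel N σ (r⁻¹ • h) := by
  rw [levyKernel, norm_smul, norm_inv, Real.norm_of_nonneg hr.le,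
    Real.mul_rpow (by positivity) (by positivity), Real.inv_rpow hr.le, Real.rpow_neg hr.le]
  have := Real.rpow_pos_of_pos hr ((N : ℝ) + 2 * σ)
  rcases eq_or_ne (‖h‖ ^ ((N : ℝ) + 2 * σ)) 0 with h0 | h0
  · simp [h0]
  · field_simp

theorem integrable_levyKernel_inv_smul (hN : 1 ≤ N) (hσ0 : 0 < σ) (hσ1 : σ < 1) {r : ℝ}
    (hr : 0 < r) : Integrable fun h : EuclideanSpace ℝ (Fin N) =>
      min 1 (‖r⁻¹ • h‖ ^ 2) / ‖h‖ ^ ((N : ℝ) + 2 * σ) := by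
  simp_rw [min_div_eq_levyKernel_inv_smul hr]
  exact ((integrable_levyKernel hN hσ0 hσ1).comp_smul (inv_ne_zero hr.ne')).const_mul _

/-- The kernel contributes `r^(-N-2σ)` and the Jacobian `r^N`. -/
theorem integral_levyKernel_inv_smul {r : ℝ} (hr : 0 < r) :
    ∫ h : EuclideanSpace ℝ (Fin N), min 1 (‖r⁻¹ • h‖ ^ 2) / ‖h‖ ^ ((N : ℝ) + 2 * σ) =
      r ^ (-2 * σ) * ∫ h, levyKernel N σ h := by
  simp_rw [min_div_eq_levyKernel_inv_smul hr]
  rw [integral_const_mul, Measure.integral_comp_inv_smul_of_nonneg _ _ hr.le,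
    finrank_euclideanSpace_fin, smul_eq_mul, ← mul_assoc, ← Real.rpow_natCast,
    ← Real.rpow_add hr]
  congr 2
  ring

/-! ### The principal value as an absolutely convergent integral -/

theorem measurable_secondDiff_div {v : EuclideanSpace ℝ (Fin N) → ℝ} (hv : Continuous v)
    (x : EuclideanSpace ℝ (Fin N)) :
    Measurable fun h => secondDiff v x h / ‖h‖ ^ ((N : ℝ) + 2 * σ) := by
  have h1 : Continuous (secondDiff v x) := by unfold secondDiff; fun_prop
  exact h1.measurable.div (measurable_norm.pow_const _)

theorem norm_secondDiff_div_le {v : EuclideanSpace ℝ (Fin N) → ℝ}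
    {x h : EuclideanSpace ℝ (Fin N)} {K : ℝ}
    (hK : |secondDiff v x h| ≤ K * min 1 (‖h‖ ^ 2)) :
    ‖secondDiff v x h / ‖h‖ ^ ((N : ℝ) + 2 * σ)‖ ≤ K * levyKernel N σ h := by
  have := Real.rpow_nonneg (norm_nonneg h) ((N : ℝ) + 2 * σ)
  rw [norm_div, Real.norm_eq_abs, Real.norm_of_nonneg this, levyKernel, ← mul_div_assoc]
  gcongr

theorem integrable_secondDiff_div (hN : 1 ≤ N) (hσ0 : 0 < σ) (hσ1 : σ < 1)
    {v : EuclideanSpace ℝ (Fin N) → ℝ} (hv : Continuous v) {M : ℝ} (hM : ∀ x, |v x| ≤ M)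
    {x : EuclideanSpace ℝ (Fin N)} (hx : ContDiffAt ℝ 2 v x) :
    Integrable fun h => secondDiff v x h / ‖h‖ ^ ((N : ℝ) + 2 * σ) := by
  obtain ⟨ρ, hρ, K, hK⟩ := exists_secondDiff_le_min hx hM
  exact ((integrable_levyKernel hN hσ0 hσ1).const_mul K).mono'
    (measurable_secondDiff_div hv x).aestronglyMeasurable
    (ae_of_all _ fun h => norm_secondDiff_div_le (hK x (by simpa using hρ) h))

theorem continuousAt_symmFracIntegral (hN : 1 ≤ N) (hσ0 : 0 < σ) (hσ1 : σ < 1)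
    {v : EuclideanSpace ℝ (Fin N) → ℝ} (hv : Continuous v) {M : ℝ} (hM : ∀ x, |v x| ≤ M)
    {x : EuclideanSpace ℝ (Fin N)} (hx : ContDiffAt ℝ 2 v x) :
    ContinuousAt (symmFracIntegral σ v) x := by
  obtain ⟨ρ, hρ, K, hK⟩ := exists_secondDiff_le_min hx hM
  refine continuousAt_const.mul (continuousAt_of_dominated
    (Eventually.of_forall fun y => (measurable_secondDiff_div hv y).aestronglyMeasurable) ?_
    ((integrable_levyKernel hN hσ0 hσ1).const_mul K) (ae_of_all _ fun h => ?_))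
  · filter_upwards [Metric.ball_mem_nhds x hρ] with y hy
    exact ae_of_all _ fun h => norm_secondDiff_div_le (hK y hy h)
  · have : Continuous fun y => secondDiff v y h := by unfold secondDiff; fun_prop
    exact (this.div_const _).continuousAt

/-- Average the substitutions `y = x + h` and `y = x - h`; off the ball each integral converges
absolutely. -/
theorem truncatedFracIntegral_eq_symm (hN : 1 ≤ N) (hσ0 : 0 < σ) (hσ1 : σ < 1)
    {v : EuclideanSpace ℝ (Fin N) → ℝ} (hv : Continuous v) {M : ℝ} (hM : ∀ x, |v x| ≤ M)
    (x : EuclideanSpace ℝ (Fin N)) {ε : ℝ} (hε : 0 < ε) :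
    truncatedFracIntegral σ v x ε =
      2⁻¹ * ∫ h in (Metric.ball (0 : EuclideanSpace ℝ (Fin N)) ε)ᶜ,
        secondDiff v x h / ‖h‖ ^ ((N : ℝ) + 2 * σ) := by
  set α := (N : ℝ) + 2 * σ with hα
  set G : EuclideanSpace ℝ (Fin N) → ℝ :=
    (Metric.ball x ε)ᶜ.indicator fun y => (v x - v y) / ‖x - y‖ ^ α with hG
  have hM0 : 0 ≤ M := (abs_nonneg _).trans (hM x)
  have hGint : Integrable fun h => G (x + h) := by
    have hmeas : Measurable G := by
      refine Measurable.indicator ?_ Metric.isOpen_ball.measurableSet.compl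
      exact (by fun_prop : Continuous fun y => v x - v y).measurable.div
        ((by fun_prop : Continuous fun y => ‖x - y‖).measurable.pow_const _)
    refine ((integrable_levyKernel hN hσ0 hσ1).const_mul (2 * M / min 1 (ε ^ 2))).mono'
      (hmeas.comp (measurable_const_add x)).aestronglyMeasurable (ae_of_all _ fun h => ?_)
    by_cases hh : x + h ∈ (Metric.ball x ε)ᶜ
    · rw [hG, indicator_of_mem hh]
      have hh' : ε ≤ ‖h‖ := by simpa using hh
      have h1 : |v x - v (x + h)| ≤ 2 * M := by
        have a1 := abs_le.1 (hM x)
        have a2 := abs_le.1 (hM (x + h))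
        rw [abs_le]; constructor <;> linarith
      have h2 : 0 ≤ ‖h‖ ^ α := by positivity
      rw [levyKernel, ← hα, sub_add_cancel_left, norm_neg, norm_div, Real.norm_eq_abs,
        Real.norm_of_nonneg h2, ← mul_div_assoc]
      gcongr
      have h3 : 0 < min 1 (ε ^ 2) := by positivity
      calc |v x - v (x + h)| ≤ 2 * M / min 1 (ε ^ 2) * min 1 (ε ^ 2) := by
            rw [div_mul_cancel₀ _ h3.ne']; exact h1
        _ ≤ _ := by gcongr
    · rw [hG, indicator_of_notMem hh, norm_zero]
      have := levyKernel_nonneg (σ := σ) h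
      positivity
  have hGint' : Integrable fun h => G (x - h) := by
    simpa [sub_eq_add_neg] using hGint.comp_neg
  have e1 : truncatedFracIntegral σ v x ε = ∫ y, G y := by
    rw [truncatedFracIntegral, hG, integral_indicator Metric.isOpen_ball.measurableSet.compl]
  have e2 : ∫ h, G (x + h) = ∫ y, G y := integral_add_left_eq_self G x
  have e3 : ∫ h, G (x - h) = ∫ y, G y := integral_sub_left_eq_self G _ x
  have e4 : ∫ h in (Metric.ball (0 : EuclideanSpace ℝ (Fin N)) ε)ᶜ,
      secondDiff v x h / ‖h‖ ^ α = ∫ h, (G (x + h) + G (x - h)) := by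
    rw [← integral_indicator Metric.isOpen_ball.measurableSet.compl]
    congr 1
    ext h
    by_cases hh : ε ≤ ‖h‖
    · rw [indicator_of_mem (by simpa using hh), hG, indicator_of_mem (by simpa using hh),
        indicator_of_mem (by simpa [dist_eq_norm] using hh), secondDiff]
      simp only [sub_add_cancel_left, norm_neg, sub_sub_cancel]
      ring
    · rw [indicator_of_notMem (by simpa using hh), hG, indicator_of_notMem (by simpa using hh),
        indicator_of_notMem (by simpa [dist_eq_norm] using hh), add_zero]
  rw [e4, integral_add hGint hGint', e2, e3, e1]
  ring

theorem tendsto_truncatedFracIntegral (hN : 1 ≤ N) (hσ0 : 0 < σ) (hσ1 : σ < 1)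
    {v : EuclideanSpace ℝ (Fin N) → ℝ} (hv : Continuous v) {M : ℝ} (hM : ∀ x, |v x| ≤ M)
    {x : EuclideanSpace ℝ (Fin N)} (hx : ContDiffAt ℝ 2 v x) :
    Tendsto (truncatedFracIntegral σ v x) (𝓝[>] 0) (𝓝 (symmFracIntegral σ v x)) := by
  have hint := integrable_secondDiff_div hN hσ0 hσ1 hv hM hx
  set g := fun h : EuclideanSpace ℝ (Fin N) => secondDiff v x h / ‖h‖ ^ ((N : ℝ) + 2 * σ)
    with hg
  have key : Tendsto (fun ε : ℝ => ∫ h, (Metric.ball (0 : EuclideanSpace ℝ (Fin N)) ε)ᶜ.indicator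
      g h) (𝓝[>] 0) (𝓝 (∫ h, g h)) := by
    refine tendsto_integral_filter_of_dominated_convergence (fun h => ‖g h‖)
      (Eventually.of_forall fun ε => hint.aestronglyMeasurable.indicator
        Metric.isOpen_ball.measurableSet.compl)
      (Eventually.of_forall fun ε => ae_of_all _ fun h => norm_indicator_le_norm_self _ _)
      hint.norm (ae_of_all _ fun h => ?_)
    rcases eq_or_ne h 0 with rfl | h0
    · have : g 0 = 0 := by simp [hg, secondDiff]; left; ring
      rw [this]
      refine tendsto_const_nhds.congr fun ε => ?_
      by_cases hε : (0 : EuclideanSpace ℝ (Fin N)) ∈ (Metric.ball 0 ε)ᶜ <;> simp [indicator, this]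
    · refine tendsto_const_nhds.congr' ?_
      filter_upwards [nhdsWithin_le_nhds (Iio_mem_nhds (norm_pos_iff.2 h0))] with ε hε
      rw [indicator_of_mem]
      have hε' : ε < ‖h‖ := hε
      simpa using hε'.le
  refine (key.const_mul 2⁻¹).congr' ?_
  filter_upwards [self_mem_nhdsWithin] with ε hε
  rw [truncatedFracIntegral_eq_symm hN hσ0 hσ1 hv hM x hε,
    integral_indicator Metric.isOpen_ball.measurableSet.compl]

/-- The integral ignores null sets, but `u x` enters pointwise, hence the separate `hxu`. -/
theorem fracLaplacian_eq_symm (hN : 1 ≤ N) (hσ0 : 0 < σ) (hσ1 : σ < 1)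
    {u v : EuclideanSpace ℝ (Fin N) → ℝ} (huv : u =ᵐ[volume] v) (hv : Continuous v)
    {M : ℝ} (hM : ∀ x, |v x| ≤ M)
    {x : EuclideanSpace ℝ (Fin N)} (hx : ContDiffAt ℝ 2 v x) (hxu : u x = v x) :
    fracLaplacian σ u x = fracConst N σ * symmFracIntegral σ v x := by
  have h : truncatedFracIntegral σ u x = truncatedFracIntegral σ v x := by
    ext ε
    refine integral_congr_ae (ae_restrict_of_ae ?_)
    filter_upwards [huv] with y hy
    rw [hy, hxu]
  rw [fracLaplacian, h, (tendsto_truncatedFracIntegral hN hσ0 hσ1 hv hM hx).limUnder_eq]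

/-! ### The mixed operator and its bound at touching points -/

/-- The operator `-Δv + |(-Δ)^σ v|^{p-1} (-Δ)^σ v`, with the symmetrized fractional Laplacian. -/
noncomputable def mixedOperator {N : ℕ} (σ p : ℝ) (v : EuclideanSpace ℝ (Fin N) → ℝ)
    (x : EuclideanSpace ℝ (Fin N)) : ℝ :=
  -(Laplacian.laplacian v x) + |fracConst N σ * symmFracIntegral σ v x| ^ (p - 1) *
    (fracConst N σ * symmFracIntegral σ v x)

variable {p : ℝ}

theorem fracConst_nonneg (hσ0 : 0 < σ) (hσ1 : σ < 1) : 0 ≤ fracConst N σ := by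
  have h1 : 0 < Real.Gamma ((N : ℝ) / 2 + σ) := Real.Gamma_pos_of_pos (by positivity)
  have h2 : 0 < Real.Gamma (1 - σ) := Real.Gamma_pos_of_pos (by linarith)
  unfold fracConst
  positivity

theorem abs_rpow_mul_le {s t : ℝ} (hp : 1 ≤ p) (hst : s ≤ t) (ht : 0 ≤ t) :
    |s| ^ (p - 1) * s ≤ t ^ p := by
  rcases le_or_gt s 0 with hs | hs
  · exact (mul_nonpos_of_nonneg_of_nonpos (by positivity) hs).trans (by positivity)
  · rw [abs_of_pos hs, ← Real.rpow_add_one hs.ne', sub_add_cancel]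
    exact Real.rpow_le_rpow hs.le hst (by linarith)

theorem continuousAt_mixedOperator (hN : 1 ≤ N) (hσ0 : 0 < σ) (hσ1 : σ < 1) (hp : 1 ≤ p)
    {v : EuclideanSpace ℝ (Fin N) → ℝ} (hv : Continuous v) {M : ℝ} (hM : ∀ x, |v x| ≤ M)
    {x : EuclideanSpace ℝ (Fin N)} (hx : ContDiffAt ℝ 2 v x) :
    ContinuousAt (mixedOperator σ p v) x := by
  have h1 : ContinuousAt (fun y => fracConst N σ * symmFracIntegral σ v y) x :=
    (continuousAt_symmFracIntegral hN hσ0 hσ1 hv hM hx).const_mul _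
  exact (continuousAt_laplacian hx).neg.add
    ((h1.abs.rpow_const (Or.inr (by linarith))).mul h1)

/-- The operator at a point where `v` is touched from below by a truncated paraboloid of height
`η` and width `r`. -/
theorem mixedOperator_le (hN : 1 ≤ N) (hσ0 : 0 < σ) (hσ1 : σ < 1) (hp : 1 ≤ p)
    {v : EuclideanSpace ℝ (Fin N) → ℝ} (hv : Continuous v) {M : ℝ} (hM : ∀ x, |v x| ≤ M)
    {x : EuclideanSpace ℝ (Fin N)} (hx : ContDiffAt ℝ 2 v x) {η r : ℝ} (hη : 0 ≤ η) (hr : 0 < r)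
    (h : ∀ h, secondDiff v x h ≤ 2 * η * min 1 (‖r⁻¹ • h‖ ^ 2)) :
    mixedOperator σ p v x ≤ 2 * (η / r ^ 2) * N +
      (fracConst N σ * (η * (r ^ (-2 * σ) * ∫ h, levyKernel N σ h))) ^ p := by
  have hc := fracConst_nonneg (N := N) hσ0 hσ1
  have hK : 0 ≤ ∫ h, levyKernel N σ h := integral_nonneg fun h => levyKernel_nonneg h
  refine add_le_add (neg_laplacian_le hx (Eventually.of_forall fun k => ?_))
    (abs_rpow_mul_le hp (mul_le_mul_of_nonneg_left ?_ hc) (by positivity))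
  · refine (h k).trans ?_
    calc 2 * η * min 1 (‖r⁻¹ • k‖ ^ 2) ≤ 2 * η * ‖r⁻¹ • k‖ ^ 2 := by
          gcongr; exact min_le_right _ _
      _ = _ := by
        rw [norm_smul, norm_inv, Real.norm_of_nonneg hr.le]
        field_simp
  · have hle : ∫ k, secondDiff v x k / ‖k‖ ^ ((N : ℝ) + 2 * σ) ≤
        ∫ k : EuclideanSpace ℝ (Fin N),
          2 * η * (min 1 (‖r⁻¹ • k‖ ^ 2) / ‖k‖ ^ ((N : ℝ) + 2 * σ)) := by
      refine integral_mono (integrable_secondDiff_div hN hσ0 hσ1 hv hM hx)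
        ((integrable_levyKernel_inv_smul hN hσ0 hσ1 hr).const_mul _) fun k => ?_
      dsimp only
      rw [← mul_div_assoc]
      gcongr
      exact h k
    rw [integral_const_mul, integral_levyKernel_inv_smul hr] at hle
    rw [symmFracIntegral]
    linarith

/-! ### Minimum principle and paraboloid barrier -/

theorem forall_le_of_ae_le {X : Type*} [TopologicalSpace X] [MeasurableSpace X]
    {μ : Measure X} [μ.IsOpenPosMeasure] [OpensMeasurableSpace X] {Ω : Set X} (hΩ : IsOpen Ω)
    {g : X → ℝ} (hg : ∀ x ∈ Ω, ContinuousAt g x) {κ : ℝ}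
    (h : ∀ᵐ x ∂(μ.restrict Ω), κ ≤ g x) : ∀ x ∈ Ω, κ ≤ g x := by
  intro x hx
  by_contra! hlt
  rw [ae_restrict_iff' hΩ.measurableSet] at h
  have h1 : {y | y ∈ Ω ∧ g y < κ} ∈ 𝓝 x :=
    inter_mem (hΩ.mem_nhds hx) ((hg x hx).eventually (Iio_mem_nhds hlt))
  refine (Measure.measure_pos_of_mem_nhds μ h1).ne' (measure_mono_null (fun y hy => ?_) h)
  simp only [mem_compl_iff, mem_ofPred_eq, not_forall, not_le]
  exact ⟨hy.1, hy.2⟩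

/-- A connected set that meets `Ω` but misses its frontier stays in `Ω`. -/
theorem ball_infDist_frontier_subset {E : Type*} [NormedAddCommGroup E] [NormedSpace ℝ E]
    {Ω : Set E} (hΩ : IsOpen Ω) {z : E} (hz : z ∈ Ω) :
    Metric.ball z (Metric.infDist z (frontier Ω)) ⊆ Ω := by
  rcases le_or_gt (Metric.infDist z (frontier Ω)) 0 with h0 | h0
  · rw [Metric.ball_eq_empty.2 h0]; exact empty_subset _
  refine (convex_ball z _).isPreconnected.subset_of_closure_inter_subset hΩ
    ⟨z, Metric.mem_ball_self h0, hz⟩ ?_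
  rintro y ⟨hyc, hyb⟩
  by_contra hy
  have : y ∈ frontier Ω := by rw [hΩ.frontier_eq]; exact ⟨hyc, hy⟩
  have h1 := Metric.infDist_le_dist_of_mem (x := z) this
  rw [Metric.mem_ball, dist_comm] at hyb
  linarith

/-- Positivity of functions with a positive operator. -/
theorem nonneg_of_mixedOperator_pos (hN : 1 ≤ N) (hσ0 : 0 < σ) (hσ1 : σ < 1) (hp : 1 ≤ p)
    {Ω : Set (EuclideanSpace ℝ (Fin N))} (hΩb : Bornology.IsBounded Ω)
    {v : EuclideanSpace ℝ (Fin N) → ℝ} (hv : Continuous v) {M : ℝ} (hM : ∀ x, |v x| ≤ M)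
    (hv2 : ∀ x ∈ Ω, ContDiffAt ℝ 2 v x) (hv0 : ∀ x ∉ Ω, v x = 0)
    (hpos : ∀ x ∈ Ω, 0 < mixedOperator σ p v x) (x : EuclideanSpace ℝ (Fin N)) : 0 ≤ v x := by
  by_contra! hx
  have hxΩ : x ∈ Ω := by by_contra h; rw [hv0 x h] at hx; exact lt_irrefl _ hx
  obtain ⟨y, -, hy⟩ := hΩb.isCompact_closure.exists_isMinOn ⟨x, subset_closure hxΩ⟩ hv.continuousOn
  have hyx : v y ≤ v x := hy (subset_closure hxΩ)
  have hmin : ∀ w, v y ≤ v w := fun w => by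
    by_cases hw : w ∈ Ω
    · exact hy (subset_closure hw)
    · rw [hv0 w hw]; linarith
  have hyΩ : y ∈ Ω := by by_contra h; rw [hv0 y h] at hyx; linarith
  -- At a global minimum, height `η = 0` is admissible, so the operator is at most `0`.
  have h1 := mixedOperator_le hN hσ0 hσ1 hp hv hM (hv2 y hyΩ) le_rfl one_pos (fun h => by
    have a1 := hmin (y + h)
    have a2 := hmin (y - h)
    rw [secondDiff]
    linarith)
  have h2 := hpos y hyΩ
  rw [zero_mul, mul_zero, Real.zero_rpow (by linarith)] at h1
  simp at h1
  linarith

theorem secondDiff_paraboloid {N : ℕ} (z x h : EuclideanSpace ℝ (Fin N)) (η r : ℝ) :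
    secondDiff (fun y => η * (1 - ‖y - z‖ ^ 2 / r ^ 2)) x h = 2 * η * (‖h‖ ^ 2 / r ^ 2) := by
  have key : ‖x + h - z‖ ^ 2 + ‖x - h - z‖ ^ 2 = 2 * ‖x - z‖ ^ 2 + 2 * ‖h‖ ^ 2 := by
    have := parallelogram_law_with_norm ℝ (x - z) h
    rw [show x + h - z = x - z + h by abel, show x - h - z = x - z - h by abel]
    linarith
  simp only [secondDiff]
  linear_combination (η / r ^ 2) * key

/-- A lower bound for `v` that does not depend on the distance to the boundary. -/
theorem le_of_mixedOperator_ge (hN : 1 ≤ N) (hσ0 : 0 < σ) (hσ1 : σ < 1) (hp : 1 ≤ p)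
    (hσp : σ * p ≤ 1) {Ω : Set (EuclideanSpace ℝ (Fin N))} (hΩ : IsOpen Ω)
    {v : EuclideanSpace ℝ (Fin N) → ℝ} (hv : Continuous v) {M : ℝ} (hM : ∀ x, |v x| ≤ M)
    (hv2 : ∀ x ∈ Ω, ContDiffAt ℝ 2 v x) (hvn : ∀ x, 0 ≤ v x) {κ : ℝ}
    (hop : ∀ x ∈ Ω, κ ≤ Metric.infDist x (frontier Ω) ^ 2 * mixedOperator σ p v x)
    {η : ℝ} (hη0 : 0 < η) (hη1 : η ≤ 1)
    (hη : (18 * N + 9 * (fracConst N σ * ∫ h, levyKernel N σ h) ^ p) * η < κ)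
    {z : EuclideanSpace ℝ (Fin N)} (hz : z ∈ Ω) (hz0 : 0 < Metric.infDist z (frontier Ω))
    (hz2 : Metric.infDist z (frontier Ω) ≤ 2) : η ≤ v z := by
  by_contra! hlt
  -- Half the distance keeps the closed ball inside `Ω` and gives `d ≤ 3r` on it.
  set r := Metric.infDist z (frontier Ω) / 2 with hr
  have hr0 : 0 < r := by positivity
  have hr1 : r ≤ 1 := by linarith
  set φ : EuclideanSpace ℝ (Fin N) → ℝ := fun y => η * (1 - ‖y - z‖ ^ 2 / r ^ 2) with hφ
  have hφc : Continuous φ := by rw [hφ]; fun_prop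
  obtain ⟨x, hxb, hx⟩ := (isCompact_closedBall z r).exists_isMinOn
    ⟨z, Metric.mem_closedBall_self hr0.le⟩ (hv.sub hφc).continuousOn
  have hxz : v x - φ x ≤ v z - φ z := hx (Metric.mem_closedBall_self hr0.le)
  have hφz : φ z = η := by simp [hφ]
  have hφle : φ x ≤ η := by
    have : 0 ≤ ‖x - z‖ ^ 2 / r ^ 2 := by positivity
    simp only [hφ]
    nlinarith
  have hmin : ∀ y, v x - φ x ≤ v y - φ y := by
    intro y
    by_cases hy : y ∈ Metric.closedBall z r
    · exact hx hy
    · rw [Metric.mem_closedBall, dist_eq_norm, not_le] at hy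
      have h1 : 1 ≤ ‖y - z‖ ^ 2 / r ^ 2 := by
        rw [le_div_iff₀ (by positivity)]; nlinarith
      have h2 : φ y ≤ 0 := mul_nonpos_of_nonneg_of_nonpos hη0.le (by linarith)
      linarith [hvn y]
  have hxΩ : x ∈ Ω := by
    refine ball_infDist_frontier_subset hΩ hz (Metric.closedBall_subset_ball ?_ hxb)
    linarith
  -- The bound `2η` uses `v ≥ 0` and `v x < φ x ≤ η`; the quadratic one uses that `v - φ` is
  -- globally minimal at `x`.
  have hsd : ∀ h, secondDiff v x h ≤ 2 * η * min 1 (‖r⁻¹ • h‖ ^ 2) := by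
    intro h
    rw [mul_min_of_nonneg _ _ (by positivity), le_min_iff]
    constructor
    · rw [secondDiff]
      linarith [hvn (x + h), hvn (x - h)]
    · have h1 := secondDiff_paraboloid z x h η r
      rw [← hφ] at h1
      rw [norm_smul, norm_inv, Real.norm_of_nonneg hr0.le, mul_pow, inv_pow,
        ← div_eq_inv_mul, ← h1, secondDiff, secondDiff]
      linarith [hmin (x + h), hmin (x - h)]
  have hle := mixedOperator_le hN hσ0 hσ1 hp hv hM (hv2 x hxΩ) hη0.le hr0 hsd
  set A := fracConst N σ * ∫ h, levyKernel N σ h with hA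
  have hA0 : 0 ≤ A := mul_nonneg (fracConst_nonneg hσ0 hσ1)
    (integral_nonneg fun h => levyKernel_nonneg h)
  have hpow : (fracConst N σ * (η * (r ^ (-2 * σ) * ∫ h, levyKernel N σ h))) ^ p ≤
      A ^ p * η / r ^ 2 := by
    rw [show fracConst N σ * (η * (r ^ (-2 * σ) * ∫ h, levyKernel N σ h)) =
      A * η * r ^ (-2 * σ) by rw [hA]; ring, Real.mul_rpow (by positivity) (by positivity),
      Real.mul_rpow hA0 hη0.le, ← Real.rpow_mul hr0.le, div_eq_mul_inv]
    gcongr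
    · simpa using Real.rpow_le_rpow_of_exponent_ge hη0 hη1 hp
    · rw [← Real.rpow_natCast, ← Real.rpow_neg hr0.le]
      -- Here `σp ≤ 1` is decisive: the nonlocal term is no more singular than `r^(-2)`.
      refine Real.rpow_le_rpow_of_exponent_ge hr0 hr1 ?_
      push_cast
      linarith
  have hd : Metric.infDist x (frontier Ω) ≤ 3 * r := by
    have := Metric.infDist_le_infDist_add_dist (s := frontier Ω) (x := x) (y := z)
    rw [Metric.mem_closedBall] at hxb
    linarith
  have hB : 0 ≤ 2 * (η / r ^ 2) * N + A ^ p * η / r ^ 2 := by positivity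
  have hfin : κ ≤ (3 * r) ^ 2 * (2 * (η / r ^ 2) * N + A ^ p * η / r ^ 2) := by
    refine (hop x hxΩ).trans ?_
    have := Metric.infDist_nonneg (x := x) (s := frontier Ω)
    calc _ ≤ Metric.infDist x (frontier Ω) ^ 2 * (2 * (η / r ^ 2) * N + A ^ p * η / r ^ 2) := by
          gcongr; linarith
      _ ≤ _ := by gcongr
  have e : (3 * r) ^ 2 * (2 * (η / r ^ 2) * N + A ^ p * η / r ^ 2) =
      (18 * N + 9 * A ^ p) * η := by
    field_simp
    ring
  linarith

end

end MixedPower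

/-! ### Contradiction at the boundary -/

open MixedPower in
theorem theorem1p4 (N : ℕ) (hN : 1 ≤ N) (Ω : Set (EuclideanSpace ℝ (Fin N)))
    (hΩ : MixedPower.IsBoundedDomain Ω) (hΩ2 : MixedPower.HasC2Boundary Ω)
    (σ : ℝ) (hσ0 : 0 < σ) (hσ1 : σ < 1)
    (f : EuclideanSpace ℝ (Fin N) → ℝ) (hf : MixedPower.MemLinftyLoc Ω f)
    (κ : ℝ) (hκ : 0 < κ)
    (hfκ : ∀ᵐ x ∂(volume.restrict Ω), κ ≤ Metric.infDist x (frontier Ω) ^ 2 * f x)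
    (p : ℝ) (hp1 : 1 ≤ p) (hpσ : p < 1 / σ) :
    ¬ ∃ u : EuclideanSpace ℝ (Fin N) → ℝ,
      MixedPower.IsSolution Ω σ p f (fun _ => 0) (fun _ => 0) u := by
  rintro ⟨u, hu⟩
  have hΩo := hΩ.isOpen
  have hcomp : IsCompact (closure Ω) := hΩ.isBounded.isCompact_closure
  -- The values of `u` outside the closure are known only almost everywhere; the zero extension is
  -- an everywhere continuous representative.
  set v := Ω.indicator u with hvdef
  have hvu : ∀ x ∈ closure Ω, v x = u x := by
    intro x hx
    by_cases hxΩ : x ∈ Ω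
    · exact indicator_of_mem hxΩ u
    · have hxf : x ∈ frontier Ω := by rw [hΩo.frontier_eq]; exact ⟨hx, hxΩ⟩
      rw [hvdef, indicator_of_notMem hxΩ, hu.boundary x hxf]
  have hv0 : ∀ x ∉ Ω, v x = 0 := fun x hx => indicator_of_notMem hx u
  have huv : u =ᵐ[volume] v := by
    have h := hu.exterior
    rw [ae_restrict_iff' isClosed_closure.isOpen_compl.measurableSet] at h
    filter_upwards [h] with x hx
    by_cases hxc : x ∈ closure Ω
    · exact (hvu x hxc).symm
    · rw [hx hxc, hv0 x fun hxΩ => hxc (subset_closure hxΩ)]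
  have hv : Continuous v := continuous_indicator hu.boundary hu.continuousOn
  obtain ⟨M, hM⟩ : ∃ M, ∀ x, |v x| ≤ M := by
    obtain ⟨C, hC⟩ := hcomp.exists_bound_of_continuousOn hv.continuousOn
    refine ⟨max C 0, fun x => ?_⟩
    by_cases hx : x ∈ closure Ω
    · exact (hC x hx).trans (le_max_left _ _)
    · rw [hv0 x fun hxΩ => hx (subset_closure hxΩ), abs_zero]
      exact le_max_right _ _
  have heq : ∀ x ∈ Ω, v =ᶠ[𝓝 x] u := fun x hx => by
    filter_upwards [hΩo.mem_nhds hx] with y hy using indicator_of_mem hy u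
  have hv2 : ∀ x ∈ Ω, ContDiffAt ℝ 2 v x := fun x hx =>
    (hu.contDiffOn.contDiffAt (hΩo.mem_nhds hx)).congr_of_eventuallyEq (heq x hx)
  have hop : ∀ x ∈ Ω, κ ≤ Metric.infDist x (frontier Ω) ^ 2 * mixedOperator σ p v x := by
    refine forall_le_of_ae_le (μ := volume) hΩo (fun x hx => ?_) ?_
    · exact ((Metric.continuous_infDist_pt _).continuousAt.pow 2).mul
        (continuousAt_mixedOperator hN hσ0 hσ1 hp1 hv hM (hv2 x hx))
    · filter_upwards [hfκ, hu.equation, ae_restrict_mem hΩo.measurableSet] with x h1 h2 hx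
      rw [mixedOperator, InnerProductSpace.laplacian_congr_nhds (heq x hx) |>.self_of_nhds,
        ← fracLaplacian_eq_symm hN hσ0 hσ1 huv hv hM (hv2 x hx) (hvu x (subset_closure hx)).symm,
        h2]
      exact h1
  have hpos : ∀ x ∈ Ω, 0 < mixedOperator σ p v x := fun x hx =>
    pos_of_mul_pos_right (hκ.trans_le (hop x hx)) (sq_nonneg _)
  have hvn := nonneg_of_mixedOperator_pos hN hσ0 hσ1 hp1 hΩ.isBounded hv hM hv2 hv0 hpos
  set B := 18 * (N : ℝ) + 9 * (fracConst N σ * ∫ h, levyKernel N σ h) ^ p with hB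
  have hB0 : 0 ≤ B := by
    have h1 : 0 ≤ fracConst N σ * ∫ h, levyKernel N σ h := mul_nonneg (fracConst_nonneg hσ0 hσ1)
      (integral_nonneg fun h => levyKernel_nonneg h)
    positivity
  obtain ⟨η, hη0, hη1, hη⟩ : ∃ η : ℝ, 0 < η ∧ η ≤ 1 ∧ B * η < κ := by
    refine ⟨min 1 (κ / (B + 1)), by positivity, min_le_left _ _, ?_⟩
    calc B * min 1 (κ / (B + 1)) ≤ B * (κ / (B + 1)) := by gcongr; exact min_le_right _ _
      _ < κ := by
        rw [← mul_div_assoc, div_lt_iff₀ (by positivity)]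
        nlinarith
  have : Nonempty (Fin N) := ⟨⟨0, hN⟩⟩
  obtain ⟨x₀, hx₀⟩ : (frontier Ω).Nonempty := by
    refine nonempty_frontier_iff.2 ⟨hΩ.isConnected.nonempty, fun h => ?_⟩
    exact NormedSpace.unbounded_univ ℝ (EuclideanSpace ℝ (Fin N)) (h ▸ hΩ.isBounded)
  have hx₀Ω : x₀ ∉ Ω := fun h => by rw [hΩo.frontier_eq] at hx₀; exact hx₀.2 h
  have hev : ∀ᶠ z in 𝓝 x₀, v z < η ∧ dist z x₀ < 2 :=
    (hv.continuousAt.eventually (Iio_mem_nhds (by rw [hv0 x₀ hx₀Ω]; exact hη0))).and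
      (Metric.ball_mem_nhds x₀ two_pos)
  -- A point of `Ω` so close to `x₀` that continuity forces `v z < η`.
  obtain ⟨z, ⟨hzη, hz2⟩, hz⟩ :=
    mem_closure_iff_nhds.1 (frontier_subset_closure hx₀) _ hev
  have hd0 : 0 < Metric.infDist z (frontier Ω) := by
    refine (isClosed_frontier.notMem_iff_infDist_pos ⟨x₀, hx₀⟩).1 fun h => ?_
    rw [hΩo.frontier_eq] at h
    exact h.2 hz
  have hσp : σ * p ≤ 1 := by
    rw [lt_div_iff₀ hσ0] at hpσ
    linarith
  exact hzη.not_ge (le_of_mixedOperator_ge hN hσ0 hσ1 hp1 hσp hΩo hv hM hv2 hvn hop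
    hη0 hη1 hη hz hd0 ((Metric.infDist_le_dist_of_mem hx₀).trans hz2.le))
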